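/- Let $X$ be a Tychonoff space, and let $C_p(X)$ be the set $C(X)$ of continuous real-valued functions on $X$ with the topology of pointwise convergence. Then the following statements are equivalent: 1. $C_p(X)$ satisfies $U_{fin}(\mathcal S,\mathcal D)$ and is sequentially separable; 2. $X$ satisfies $U_{fin}(\Gamma_F,\Omega)$ and has property $V$; 3. $C_p(X)$ satisfies $U_{fin}(\Gamma_x,\Omega_x)$ and is sequentially separable; 4. $C_p(X)$ satisfies $U_{fin}(\mathcal S,\Omega_x)$ and is sequentially separable. Definitions. *Sequential density.* A subset $D$ of a space $E$ is sequentially dense if every point of $E$ is the limit of a sequence of points of $D$; $\mathcal S$ is the family of sequentially dense subsets; $E$ is sequentially separable if it has a countable sequentially dense subset. *Covers.* A cover $\mathcal U$ of $X$ is a family of subsets of $X$ with $\bigcup\mathcal U=X$ and $X\notin\mathcal U$. It is a $\gamma$-cover if it is infinite and each $x\in X$ belongs to all but finitely many members of $\mathcal U$; it is an $\omega$-cover if each finite subset of $X$ is contained in a member of $\mathcal U$. $\Omega$ is the family of $\omega$-covers of $X$ by open sets. A zero-set is a set $f^{-1}(0)$ with $f\in C(X)$, and a cozero-set is the complement of a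 zero-set. $\Gamma_F$ is the family of $\gamma$-covers $\mathcal U$ of $X$ by cozero-sets for which there is a $\gamma$-cover $\{F(U):U\in\mathcal U\}$ of $X$ by zero-sets with $F(U)\subseteq U$ for all $U\in\mathcal U$. $X$ satisfies $U_{fin}(\Gamma_F,\Omega)$ if for every sequence $(\mathcal U_n)_{n\in\mathbb N}$ in $\Gamma_F$ such that no $\mathcal U_n$ has a finite subfamily with union $X$, there are finite $\mathcal F_n\subseteq\mathcal U_n$ with $\{\bigcup\mathcal F_n:n\in\mathbb N\}\in\Omega$. *Property $V$.* There is a continuous bijection $f:X\to Y$ onto a separable metric space $Y$ such that $f(U)$ is an $F_\sigma$-set in $Y$ for every cozero-set $U\subseteq X$. *Selection in $C_p(X)$.* For $f\in C(X)$, let $\Gamma_f$ be the family of infinite sets $A\subseteq C(X)$ with $f\notin A$ such that $A\setminus W$ is finite for every neighbourhood $W$ of $f$ in $C_p(X)$. For a sequence $(\mathcal F_n)_{n\in\mathbb N}$ of finite subsets of $C(X)$, write $\{\bigcup\mathcal F_n:n\in\mathbb N\}\in\Omega_f$ if for every finite $K\subseteq X$ and every $\varepsilon>0$ there is an $n$ such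 that for each $x\in K$ there is $g\in\mathcal F_n$ with $|g(x)-f(x)|<\varepsilon$; write $\{\bigcup\mathcal F_n:n\in\mathbb N\}\in\mathcal D$ if this holds for every $f\in C(X)$. $C_p(X)$ satisfies $U_{fin}(\mathcal S,\mathcal D)$ if for every sequence $(A_n)_{n\in\mathbb N}$ of sequentially dense subsets of $C_p(X)$ there are finite $\mathcal F_n\subseteq A_n$ with $\{\bigcup\mathcal F_n:n\in\mathbb N\}\in\mathcal D$. It satisfies $U_{fin}(\Gamma_x,\Omega_x)$ (respectively $U_{fin}(\mathcal S,\Omega_x)$) if for every $f\in C(X)$ and every sequence $(A_n)_{n\in\mathbb N}$ of members of $\Gamma_f$ (respectively of sequentially dense subsets of $C_p(X)$) there are finite $\mathcal F_n\subseteq A_n$ with $\{\bigcup\mathcal F_n:n\in\mathbb N\}\in\Omega_f$. -/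

import Mathlib

namespace SelectionCp

universe u

section Covers

variable {X : Type u} [TopologicalSpace X]

/-- Zero-sets of `X`: preimages of `0` under continuous real-valued functions. -/
def IsZeroSet (Z : Set X) : Prop := ∃ f : X → ℝ, Continuous f ∧ Z = f ⁻¹' {0}

/-- Cozero-sets of `X`: complements of zero-sets. -/
def IsCozeroSet (U : Set X) : Prop := IsZeroSet Uᶜ

/-- `F_σ`-sets: countable unions of closed sets. -/
def IsFSigma (A : Set X) : Prop := ∃ C : ℕ → Set X, (∀ n, IsClosed (C n)) ∧ A = ⋃ n, C n

/-- Nontrivial covers: the whole space is the union of the family, but is not a member of it. -/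
def IsNontrivialCover (𝒰 : Set (Set X)) : Prop := ⋃₀ 𝒰 = Set.univ ∧ Set.univ ∉ 𝒰

/-- `γ`-covers (by arbitrary sets): infinite nontrivial covers such that each point belongs to
all but finitely many members. -/
def IsGammaCover (𝒰 : Set (Set X)) : Prop :=
  IsNontrivialCover 𝒰 ∧ 𝒰.Infinite ∧ ∀ x : X, {U ∈ 𝒰 | x ∉ U}.Finite

variable (X) in
/-- `Ω`: the family of open `ω`-covers of `X`. -/
def OmegaCovers : Set (Set (Set X)) :=
  {𝒰 | IsNontrivialCover 𝒰 ∧ (∀ U ∈ 𝒰, IsOpen U) ∧ ∀ K : Finset X, ∃ U ∈ 𝒰, (K : Set X) ⊆ U}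

variable (X) in
/-- `Γ_F`: the family of `γ_F`-shrinkable `γ`-covers of `X`, that is, the `γ`-covers `𝒰` by
cozero-sets for which there is a `γ`-cover `{F U | U ∈ 𝒰}` by zero-sets with `F U ⊆ U`. -/
def GammaFCovers : Set (Set (Set X)) :=
  {𝒰 | IsGammaCover 𝒰 ∧ (∀ U ∈ 𝒰, IsCozeroSet U) ∧
    ∃ F : Set X → Set X, (∀ U ∈ 𝒰, IsZeroSet (F U) ∧ F U ⊆ U) ∧ IsGammaCover (F '' 𝒰)}

/-- The selection principle `U_fin(𝒜, ℬ)` for families `𝒜`, `ℬ` of covers of `X`. -/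
def UFinCovers (𝒜 ℬ : Set (Set (Set X))) : Prop :=
  ∀ 𝒰 : ℕ → Set (Set X), (∀ n, 𝒰 n ∈ 𝒜) →
    (∀ n, ∀ ℱ ⊆ 𝒰 n, ℱ.Finite → ⋃₀ ℱ ≠ Set.univ) →
    ∃ ℱ : ℕ → Set (Set X), (∀ n, (ℱ n).Finite ∧ ℱ n ⊆ 𝒰 n) ∧
      Set.range (fun n => ⋃₀ ℱ n) ∈ ℬ

variable (X) in
/-- Property `V`: there is a condensation (continuous bijection) of `X` onto a separable metric
space that maps cozero-sets to `F_σ`-sets. (A space in bijection with `X` may be taken in the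
universe of `X`.) -/
def PropertyV : Prop :=
  ∃ (Y : Type u) (_ : MetricSpace Y) (_ : TopologicalSpace.SeparableSpace Y) (f : X → Y),
    Continuous f ∧ Function.Bijective f ∧ ∀ U : Set X, IsCozeroSet U → IsFSigma (f '' U)

end Covers

section SequentialDensity

variable {E : Type u} [TopologicalSpace E]

/-- Sequentially dense sets: every point of the space is the limit of a sequence from the set. -/
def IsSeqDense (D : Set E) : Prop := seqClosure D = Set.univ

variable (E) in
/-- `𝒮`: the family of sequentially dense sets. -/
def SeqDenseSets : Set (Set E) := {D | IsSeqDense D}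

variable (E) in
/-- Sequentially separable spaces: there is a countable sequentially dense set. -/
def IsSeqSeparable : Prop := ∃ D : Set E, D.Countable ∧ IsSeqDense D

/-- `Γ_x`: the family of sets converging to the point `x`, that is, infinite sets `A` with
`x ∉ A` such that `A \ U` is finite for every neighbourhood `U` of `x`. -/
def GammaAt (x : E) : Set (Set E) :=
  {A | A.Infinite ∧ x ∉ A ∧ ∀ U ∈ nhds x, (A \ U).Finite}

end SequentialDensity

section FunctionSpace

/-- `C_p(X)`: continuous real-valued functions on `X`, with the topology of pointwise convergence
(the topology of a subspace of the product `X → ℝ`). -/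
abbrev Cp (X : Type u) [TopologicalSpace X] : Type u := {f : X → ℝ // Continuous f}

variable {X : Type u} [TopologicalSpace X]

/-- The meaning of `{⋃ ℱ n | n ∈ ℕ} ∈ Ω_f` in `U_fin`-principles for `C_p(X)`: for each basic
neighbourhood `⟨f, K, ε⟩` of `f` there is an `n` such that at each point of `K` some member of
`ℱ n` is `ε`-close to `f`. -/
def OmegaAt (f : Cp X) : Set (ℕ → Set (Cp X)) :=
  {ℱ | ∀ K : Finset X, ∀ ε : ℝ, 0 < ε → ∃ n, ∀ x ∈ K, ∃ g ∈ ℱ n, |g.1 x - f.1 x| < ε}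

variable (X) in
/-- The meaning of `{⋃ ℱ n | n ∈ ℕ} ∈ 𝒟` in `U_fin`-principles for `C_p(X)`. -/
def DenseSequences : Set (ℕ → Set (Cp X)) := {ℱ | ∀ f : Cp X, ℱ ∈ OmegaAt f}

/-- The selection principle `U_fin(𝒜, ℬ)` for `C_p(X)`. -/
def UFinCp (𝒜 : Set (Set (Cp X))) (ℬ : Set (ℕ → Set (Cp X))) : Prop :=
  ∀ A : ℕ → Set (Cp X), (∀ n, A n ∈ 𝒜) →
    ∃ ℱ : ℕ → Set (Cp X), (∀ n, (ℱ n).Finite ∧ ℱ n ⊆ A n) ∧ ℱ ∈ ℬ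

end FunctionSpace

end SelectionCp

/-!
Near a function `f`, selections in `C_p(X)` correspond to selections of covers through the
cozero-sets `{x | |g x - f x| < ε}`: sets converging to `f` give members of `Γ_F` at each level
`ε = 1 / (n + 1)`, unless at that level finitely many of these sets already cover `X`. If finite
covering happens for infinitely many `n`, the finite families themselves approximate `f` everywhere;
otherwise `U_fin(Γ_F, Ω)` selects them. Conversely, for a cover in `Γ_F`, the functions equal to
`f + 1` off some member are sequentially dense, and where such a function is within `1` of `f` the
point lies in that member.

Property `V` is sequential separability read through a map of `X` into a second countable metrizable
space under which cozero-sets are preimages of `F_σ`-sets. Evaluation at a countable sequentially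
dense set is such a map. In the other direction the map may be taken into the Hilbert cube `K`; by
the argument of Lebesgue and Hausdorff every continuous function on `X` is then a pointwise limit
of functions `h ∘ i` with `h ∈ C(K, ℝ)`, and `C(K, ℝ)` is separable.
-/

open Filter Topology TopologicalSpace

namespace SelectionCp

section Sets

variable {X Y : Type*} [TopologicalSpace X] [TopologicalSpace Y]

theorem IsCozeroSet.isOpen {U : Set X} (hU : IsCozeroSet U) : IsOpen U := by
  obtain ⟨f, hf, hUf⟩ := hU
  rw [← isClosed_compl_iff, hUf]
  exact isClosed_singleton.preimage hf

theorem isZeroSet_le {f g : X → ℝ} (hf : Continuous f) (hg : Continuous g) :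
    IsZeroSet {x | f x ≤ g x} := by
  refine ⟨fun x ↦ max 0 (f x - g x), by fun_prop, ?_⟩
  ext x
  simp

theorem isCozeroSet_lt {f g : X → ℝ} (hf : Continuous f) (hg : Continuous g) :
    IsCozeroSet {x | f x < g x} := by
  simpa only [IsCozeroSet, Set.compl_ofPred, not_lt] using isZeroSet_le hg hf

theorem IsZeroSet.exists_eqOn_zero_eqOn_one {Z W : Set X} (hZ : IsZeroSet Z) (hW : IsZeroSet W)
    (hZW : Disjoint Z W) : ∃ b : Cp X, Set.EqOn b.1 0 Z ∧ Set.EqOn b.1 1 W := by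
  obtain ⟨p, hp, rfl⟩ := hZ
  obtain ⟨q, hq, rfl⟩ := hW
  have hpos (x : X) : 0 < |p x| + |q x| := by
    by_cases hpx : p x = 0
    · have hqx : q x ≠ 0 := Set.disjoint_left.1 hZW hpx
      positivity
    · positivity
  refine ⟨⟨fun x ↦ |p x| / (|p x| + |q x|), ?_⟩, fun x hx ↦ ?_, fun x hx ↦ ?_⟩
  · exact hp.abs.div (hp.abs.add hq.abs) fun x ↦ (hpos x).ne'
  · have hpx : p x = 0 := hx
    simp [hpx]
  · have hqx : q x = 0 := hx
    simpa [hqx] using (hpos x).ne'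

theorem isFSigma_iff_of_isInducing {i : X → Y} (hi : IsInducing i) {B : Set X} :
    IsFSigma B ↔ ∃ A, IsFSigma A ∧ i ⁻¹' A = B := by
  constructor
  · rintro ⟨C, hC, rfl⟩
    choose C' hC' hCC' using fun n ↦ hi.isClosed_iff.1 (hC n)
    exact ⟨⋃ n, C' n, ⟨C', hC', rfl⟩, by simp only [Set.preimage_iUnion, hCC']⟩
  · rintro ⟨_, ⟨C, hC, rfl⟩, rfl⟩
    exact ⟨fun n ↦ i ⁻¹' C n, fun n ↦ (hC n).preimage hi.continuous, Set.preimage_iUnion⟩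

end Sets

section Covers

variable {X ι : Type*}

theorem isGammaCover_image {A : Set ι} (hA : A.Infinite) {S : ι → Set X}
    (hfin : ∀ x, {a ∈ A | x ∉ S a}.Finite) (hne : ∀ a ∈ A, S a ≠ Set.univ) :
    IsGammaCover (S '' A) := by
  refine ⟨⟨Set.eq_univ_of_forall fun x ↦ ?_, ?_⟩, fun hSA ↦ hA ?_, fun x ↦ ?_⟩
  · obtain ⟨a, ha, hax⟩ := (hA.sdiff (hfin x)).nonempty
    exact ⟨S a, ⟨a, ha, rfl⟩, by_contra fun hx ↦ hax ⟨ha, hx⟩⟩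
  · rintro ⟨a, ha, hSa⟩
    exact hne a ha hSa
  · refine Set.Finite.of_finite_fibers S hSA ?_
    rintro _ ⟨a, ha, rfl⟩
    obtain ⟨x, hx⟩ := (Set.ne_univ_iff_exists_notMem _).1 (hne a ha)
    exact (hfin x).subset fun b ⟨hb, hSb⟩ ↦ ⟨hb, fun hxb ↦ hx (hSb ▸ hxb)⟩
  · refine ((hfin x).image S).subset ?_
    rintro _ ⟨⟨a, ha, rfl⟩, hx⟩
    exact ⟨a, ⟨ha, hx⟩, rfl⟩

theorem IsGammaCover.exists_seq {𝒱 : Set (Set X)} (h𝒱 : IsGammaCover 𝒱) :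
    ∃ V : ℕ → Set X, (∀ n, V n ∈ 𝒱) ∧ ∀ x, ∀ᶠ n in atTop, x ∈ V n := by
  obtain ⟨-, hinf, hfin⟩ := h𝒱
  let e := hinf.natEmbedding
  refine ⟨fun n ↦ e n, fun n ↦ (e n).2, fun x ↦ ?_⟩
  rw [← Nat.cofinite_eq_atTop, eventually_cofinite]
  exact Set.Finite.of_injOn (f := fun n ↦ (e n : Set X)) (t := {V ∈ 𝒱 | x ∉ V})
    (fun n hn ↦ ⟨(e n).2, hn⟩)    (Subtype.val_injective.comp e.injective).injOn (hfin x)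

variable [TopologicalSpace X]

theorem image_mem_gammaFCovers {A : Set ι} (hA : A.Infinite) {U Z : ι → Set X}
    (hU : ∀ a ∈ A, IsCozeroSet (U a)) (hZ : ∀ a ∈ A, IsZeroSet (Z a)) (hZU : ∀ a ∈ A, Z a ⊆ U a)
    (hfin : ∀ x, {a ∈ A | x ∉ Z a}.Finite) (hne : ∀ a ∈ A, U a ≠ Set.univ) :
    U '' A ∈ GammaFCovers X := by
  have hγ : IsGammaCover (U '' A) := isGammaCover_image hA
    (fun x ↦ (hfin x).subset fun a ha ↦ ⟨ha.1, fun hx ↦ ha.2 (hZU a ha.1 hx)⟩) hne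
  obtain ⟨a₀, -⟩ := hA.nonempty
  have : Nonempty ι := ⟨a₀⟩
  choose! a haA hUa using fun V (hV : V ∈ U '' A) ↦ hV
  have hinj : Set.InjOn a (U '' A) := Set.LeftInvOn.injOn (f₁' := U) hUa
  refine ⟨hγ, Set.forall_mem_image.2 hU, Z ∘ a, fun V hV ↦ ⟨hZ _ (haA V hV), ?_⟩,
    isGammaCover_image hγ.2.1 (fun x ↦ ?_) fun V hV hZV ↦ hne _ (haA V hV) ?_⟩
  · exact (hZU _ (haA V hV)).trans_eq (hUa V hV)
  · exact Set.Finite.of_injOn (f := a) (t := {b ∈ A | x ∉ Z b})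
      (fun V hV ↦ ⟨haA V hV.1, hV.2⟩) (hinj.mono fun V hV ↦ hV.1) (hfin x)
  · exact Set.univ_subset_iff.1 (hZV ▸ hZU _ (haA V hV))

theorem range_mem_omegaCovers {S : ι → Set X} (hopen : ∀ a, IsOpen (S a))
    (hne : ∀ a, S a ≠ Set.univ) (hS : ∀ K : Finset X, ∃ a, (K : Set X) ⊆ S a) :
    Set.range S ∈ OmegaCovers X := by
  refine ⟨⟨Set.eq_univ_of_forall fun x ↦ ?_, ?_⟩, Set.forall_mem_range.2 hopen, fun K ↦ ?_⟩
  · obtain ⟨a, ha⟩ := hS {x}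
    exact ⟨S a, ⟨a, rfl⟩, ha (Finset.mem_coe.2 (Finset.mem_singleton_self x))⟩
  · rintro ⟨a, ha⟩
    exact hne a ha
  · obtain ⟨a, ha⟩ := hS K
    exact ⟨S a, ⟨a, rfl⟩, ha⟩

theorem frequently_subset_of_range_mem_omegaCovers {S : ℕ → Set X}
    (hS : Set.range S ∈ OmegaCovers X) (K : Finset X) : ∃ᶠ n in atTop, (K : Set X) ⊆ S n := by
  classical
  obtain ⟨⟨-, huniv⟩, -, hω⟩ := hS
  choose y hy using fun n ↦ (Set.ne_univ_iff_exists_notMem _).1 fun hn ↦ huniv ⟨n, hn⟩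
  refine frequently_atTop.2 fun m ↦ ?_
  -- Adding to `K` a point outside each of `S 0, …, S (m - 1)` excludes these members.
  obtain ⟨_, ⟨n, rfl⟩, hn⟩ := hω (K ∪ (Finset.range m).image y)
  rw [Finset.coe_union, Set.union_subset_iff, Finset.coe_image, Set.image_subset_iff] at hn
  refine ⟨n, not_lt.1 fun hnm ↦ hy n (hn.2 ?_), hn.1⟩
  exact Finset.mem_coe.2 (Finset.mem_range.2 hnm)

end Covers

section PointwiseConvergence

variable {X : Type*} [TopologicalSpace X]

theorem isSeqDense_iff {E : Type*} [TopologicalSpace E] {D : Set E} :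
    IsSeqDense D ↔ ∀ a, ∃ u : ℕ → E, (∀ n, u n ∈ D) ∧ Tendsto u atTop (𝓝 a) :=
  Set.eq_univ_iff_forall

theorem IsSeqSeparable.separableSpace {E : Type*} [TopologicalSpace E] (hE : IsSeqSeparable E) :
    SeparableSpace E := by
  obtain ⟨D, hDc, hD⟩ := hE
  exact ⟨D, hDc, fun a ↦ seqClosure_subset_closure (hD ▸ Set.mem_univ a)⟩

theorem range_mem_gammaAt {E : Type*} [TopologicalSpace E] [T1Space E] {u : ℕ → E} {a : E}
    (hu : Tendsto u atTop (𝓝 a)) (hne : ∀ n, u n ≠ a) : Set.range u ∈ GammaAt a := by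
  have ha : a ∉ Set.range u := by
    rintro ⟨n, hn⟩
    exact hne n hn
  refine ⟨fun hfin ↦ ha ?_, ha, fun W hW ↦ ?_⟩
  · exact hfin.isClosed.mem_of_tendsto hu (Eventually.of_forall Set.mem_range_self)
  · rw [← Nat.cofinite_eq_atTop] at hu
    refine (Set.Finite.image u (eventually_cofinite.1 (hu hW))).subset ?_
    rintro _ ⟨⟨n, rfl⟩, hn⟩
    exact ⟨n, hn, rfl⟩

theorem tendsto_cp_iff {ι : Type*} {l : Filter ι} {u : ι → Cp X} {g : Cp X} :
    Tendsto u l (𝓝 g) ↔ ∀ x, Tendsto (fun n ↦ (u n).1 x) l (𝓝 (g.1 x)) := by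
  rw [tendsto_subtype_rng, tendsto_pi_nhds]

/-- The set of points at which `g` is `ε`-close to `f`. Selections in `C_p(X)` near `f` are
translated into selections of covers of `X` through these cozero-sets. -/
def nearSet (f : Cp X) (ε : ℝ) (g : Cp X) : Set X := {x | |g.1 x - f.1 x| < ε}

theorem nearSet_mono (f g : Cp X) {δ ε : ℝ} (hδε : δ ≤ ε) : nearSet f δ g ⊆ nearSet f ε g :=
  fun _ hx ↦ lt_of_lt_of_le hx hδε

theorem eventually_subset_nearSet (f : Cp X) (K : Finset X) {ε : ℝ} (hε : 0 < ε) :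
    ∀ᶠ g in 𝓝 f, (K : Set X) ⊆ nearSet f ε g := by
  refine (Finset.eventually_all K).2 fun x _ ↦ ?_
  have hx : Tendsto (fun g : Cp X ↦ g.1 x) (𝓝 f) (𝓝 (f.1 x)) := tendsto_cp_iff.1 tendsto_id x
  exact Metric.tendsto_nhds.1 hx ε hε

theorem mem_omegaAt_iff {f : Cp X} {ℱ : ℕ → Set (Cp X)} :
    ℱ ∈ OmegaAt f ↔
      ∀ K : Finset X, ∀ ε : ℝ, 0 < ε → ∃ n, (K : Set X) ⊆ ⋃ g ∈ ℱ n, nearSet f ε g := by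
  simp only [OmegaAt, nearSet, Set.subset_def, Set.mem_iUnion₂, exists_prop, Finset.mem_coe,
    Set.mem_ofPred_eq]

end PointwiseConvergence

section Selection

variable {X : Type*} [TopologicalSpace X]

theorem uFinCp_denseSequences_iff [SeparableSpace (Cp X)] {𝒜 : Set (Set (Cp X))} :
    UFinCp 𝒜 (DenseSequences X) ↔ ∀ f : Cp X, UFinCp 𝒜 (OmegaAt f) := by
  refine ⟨fun h f A hA ↦ (h A hA).imp fun ℱ hℱ ↦ ⟨hℱ.1, hℱ.2 f⟩, fun h A hA ↦ ?_⟩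
  have : Nonempty (Cp X) := ⟨⟨0, continuous_zero⟩⟩
  -- The `k`-th block of indices `Nat.pair k m` is reserved for the `k`-th function `d k`.
  let d : ℕ → Cp X := denseSeq (Cp X)
  choose ℱ hℱ hΩ using fun k ↦ h (d k) (fun m ↦ A (Nat.pair k m)) fun m ↦ hA _
  refine ⟨fun n ↦ ℱ n.unpair.1 n.unpair.2, fun n ↦ ?_, fun f ↦ mem_omegaAt_iff.2 fun K ε hε ↦ ?_⟩
  · simpa only [Nat.pair_unpair] using hℱ n.unpair.1 n.unpair.2
  · obtain ⟨k, hk⟩ := (denseRange_denseSeq (Cp X)).mem_nhds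
      (eventually_subset_nearSet f K (half_pos hε))
    obtain ⟨m, hm⟩ := mem_omegaAt_iff.1 (hΩ k) K (ε / 2) (half_pos hε)
    refine ⟨Nat.pair k m, fun x hx ↦ ?_⟩
    obtain ⟨g, hg, hgd⟩ := Set.mem_iUnion₂.1 (hm hx)
    rw [Nat.unpair_pair]
    refine Set.mem_iUnion₂.2 ⟨g, hg, ?_⟩
    calc |g.1 x - f.1 x| ≤ |g.1 x - (d k).1 x| + |(d k).1 x - f.1 x| := abs_sub_le _ _ _
      _ < ε / 2 + ε / 2 := add_lt_add hgd (hk hx)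
      _ = ε := add_halves ε

theorem uFinCp_seqDenseSets_of_gammaAt {f : Cp X} (h : UFinCp (GammaAt f) (OmegaAt f)) :
    UFinCp (SeqDenseSets (Cp X)) (OmegaAt f) := by
  intro A hA
  by_cases hf : ∃ n, f ∈ A n
  · obtain ⟨n, hn⟩ := hf
    refine ⟨fun m ↦ A m ∩ {f}, fun m ↦ ⟨(Set.finite_singleton f).inter_of_right _,
      Set.inter_subset_left⟩, fun K ε hε ↦ ⟨n, fun x _ ↦ ⟨f, ⟨hn, rfl⟩, ?_⟩⟩⟩
    simpa only [sub_self, abs_zero] using hε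
  · push Not at hf
    choose u huA hu using fun n ↦ isSeqDense_iff.1 (hA n) f
    obtain ⟨ℱ, hℱ, hΩ⟩ := h (fun n ↦ Set.range (u n)) fun n ↦
      range_mem_gammaAt (hu n) fun m hm ↦ hf n (hm ▸ huA n m)
    exact ⟨ℱ, fun n ↦ ⟨(hℱ n).1, (hℱ n).2.trans (Set.range_subset_iff.2 (huA n))⟩, hΩ⟩

theorem isSeqDense_eqOn_compl {𝒰 : Set (Set X)} (h𝒰 : 𝒰 ∈ GammaFCovers X) (f : Cp X) :
    IsSeqDense {g : Cp X | ∃ U ∈ 𝒰, Set.EqOn g.1 f.1 Uᶜ} := by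
  obtain ⟨-, hcoz, F, hF, hγ⟩ := h𝒰
  obtain ⟨V, hV, hxV⟩ := hγ.exists_seq
  choose U hU hFU using hV
  have hdisj (n : ℕ) : Disjoint (V n) (U n)ᶜ :=
    Set.disjoint_compl_right_iff_subset.2 (hFU n ▸ (hF _ (hU n)).2)
  choose b hb0 hb1 using fun n ↦
    IsZeroSet.exists_eqOn_zero_eqOn_one (hFU n ▸ (hF _ (hU n)).1) (hcoz _ (hU n)) (hdisj n)
  have hcont (g : Cp X) (n : ℕ) : Continuous (g.1 + (b n).1 * (f.1 - g.1)) :=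
    g.2.add ((b n).2.mul (f.2.sub g.2))
  refine isSeqDense_iff.2 fun g ↦ ⟨fun n ↦ ⟨_, hcont g n⟩, fun n ↦ ⟨U n, hU n, fun x hx ↦ ?_⟩,
    tendsto_cp_iff.2 fun x ↦ tendsto_const_nhds.congr' ?_⟩
  · simp [hb1 n hx]
  · filter_upwards [hxV x] with n hn
    simp [hb0 n hn]

theorem uFinCovers_of_uFinCp_seqDenseSets {f : Cp X}
    (h : UFinCp (SeqDenseSets (Cp X)) (OmegaAt f)) :
    UFinCovers (GammaFCovers X) (OmegaCovers X) := by
  intro 𝒰 h𝒰 hnosub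
  obtain ⟨𝒢, h𝒢, hΩ⟩ := h (fun n ↦ {g | ∃ U ∈ 𝒰 n, Set.EqOn g.1 (f.1 + 1) Uᶜ}) fun n ↦
    isSeqDense_eqOn_compl (h𝒰 n) ⟨f.1 + 1, f.2.add continuous_const⟩
  choose! U hU𝒰 hUg using fun n g (hg : g ∈ 𝒢 n) ↦ (h𝒢 n).2 hg
  have hnear : ∀ n, ∀ g ∈ 𝒢 n, nearSet f 1 g ⊆ U n g := by
    intro n g hg x hx
    by_contra hxU
    simp [nearSet, hUg n g hg hxU] at hx
  have hfin (n : ℕ) : (U n '' 𝒢 n).Finite := (h𝒢 n).1.image _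
  have hsub (n : ℕ) : U n '' 𝒢 n ⊆ 𝒰 n := Set.image_subset_iff.2 (hU𝒰 n)
  refine ⟨fun n ↦ U n '' 𝒢 n, fun n ↦ ⟨hfin n, hsub n⟩, range_mem_omegaCovers
    (fun n ↦ isOpen_sUnion fun V hV ↦ ((h𝒰 n).2.1 V (hsub n hV)).isOpen)
    (fun n ↦ hnosub n _ (hsub n) (hfin n)) fun K ↦ ?_⟩
  obtain ⟨n, hn⟩ := mem_omegaAt_iff.1 hΩ K 1 one_pos
  exact ⟨n, (hn.trans (Set.iUnion₂_mono (hnear n))).trans_eq (Set.sUnion_image _ _).symm⟩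

theorem finite_notMem_nearSet {f : Cp X} {A : Set (Cp X)} (hA : A ∈ GammaAt f) {ε : ℝ}
    (hε : 0 < ε) (x : X) : {g ∈ A | x ∉ nearSet f ε g}.Finite := by
  refine (hA.2.2 _ (eventually_subset_nearSet f {x} hε)).subset fun g hg ↦ ⟨hg.1, fun hx ↦ ?_⟩
  exact hg.2 (hx (Finset.mem_coe.2 (Finset.mem_singleton_self x)))

theorem image_nearSet_mem_gammaFCovers {f : Cp X} {A : Set (Cp X)} (hA : A ∈ GammaAt f) {ε : ℝ}
    (hε : 0 < ε) (hne : ∀ g ∈ A, nearSet f ε g ≠ Set.univ) :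
    nearSet f ε '' A ∈ GammaFCovers X := by
  have hcont (g : Cp X) : Continuous fun x ↦ |g.1 x - f.1 x| := (g.2.sub f.2).abs
  refine image_mem_gammaFCovers hA.1 (Z := fun g ↦ {x | |g.1 x - f.1 x| ≤ ε / 2})
    (fun g _ ↦ isCozeroSet_lt (hcont g) continuous_const)
    (fun g _ ↦ isZeroSet_le (hcont g) continuous_const)
    (fun g _ x hx ↦ lt_of_le_of_lt hx (half_lt_self hε)) (fun x ↦ ?_) hne
  refine (finite_notMem_nearSet hA (half_pos hε) x).subset fun g hg ↦ ⟨hg.1, fun hx ↦ hg.2 ?_⟩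
  exact (show |g.1 x - f.1 x| < ε / 2 from hx).le

theorem mem_omegaAt_of_iUnion_nearSet_eq_univ {f : Cp X} {ℱ : ℕ → Set (Cp X)} {δ : ℕ → ℝ}
    (hδ : Tendsto δ atTop (𝓝 0)) (hℱ : ∀ n, ⋃ g ∈ ℱ n, nearSet f (δ n) g = Set.univ) :
    ℱ ∈ OmegaAt f := by
  refine mem_omegaAt_iff.2 fun K ε hε ↦ ?_
  obtain ⟨n, hn⟩ := (hδ.eventually_le_const hε).exists
  refine ⟨n, (Set.subset_univ _).trans ?_⟩
  rw [← hℱ n]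
  exact Set.iUnion₂_mono fun g _ ↦ nearSet_mono f g hn

theorem exists_mem_omegaAt_of_iUnion_nearSet_ne_univ
    (h : UFinCovers (GammaFCovers X) (OmegaCovers X)) {f : Cp X} {A : ℕ → Set (Cp X)}
    (hA : ∀ n, A n ∈ GammaAt f) {δ : ℕ → ℝ} (hδ0 : ∀ n, 0 < δ n) (hδ : Tendsto δ atTop (𝓝 0))
    (hnosub : ∀ n, ∀ ℱ ⊆ A n, ℱ.Finite → ⋃ g ∈ ℱ, nearSet f (δ n) g ≠ Set.univ) :
    ∃ ℱ : ℕ → Set (Cp X), (∀ n, (ℱ n).Finite ∧ ℱ n ⊆ A n) ∧ ℱ ∈ OmegaAt f := by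
  have hne : ∀ n, ∀ g ∈ A n, nearSet f (δ n) g ≠ Set.univ := fun n g hg ↦ by
    simpa using hnosub n {g} (Set.singleton_subset_iff.2 hg) (Set.finite_singleton g)
  obtain ⟨𝒱, h𝒱, hω⟩ := h (fun n ↦ nearSet f (δ n) '' A n)
    (fun n ↦ image_nearSet_mem_gammaFCovers (hA n) (hδ0 n) (hne n)) fun n 𝒱 h𝒱 hfin ↦ by
      obtain ⟨ℱ, hℱA, hℱ, rfl⟩ := Set.exists_subset_image_finite_and.1 ⟨𝒱, h𝒱, hfin, rfl⟩
      rw [Set.sUnion_image]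
      exact hnosub n ℱ hℱA hℱ
  choose ℱ hℱA hℱ h𝒱ℱ using fun n ↦
    Set.exists_subset_image_finite_and.1 ⟨𝒱 n, (h𝒱 n).2, (h𝒱 n).1, rfl⟩
  refine ⟨ℱ, fun n ↦ ⟨hℱ n, hℱA n⟩, mem_omegaAt_iff.2 fun K ε hε ↦ ?_⟩
  obtain ⟨n, hn, hnε⟩ := ((frequently_subset_of_range_mem_omegaCovers hω K).and_eventually
    (hδ.eventually_le_const hε)).exists
  rw [h𝒱ℱ n, Set.sUnion_image] at hn
  exact ⟨n, hn.trans (Set.iUnion₂_mono fun g _ ↦ nearSet_mono f g hnε)⟩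

theorem exists_mem_omegaAt_of_comp_injective {f : Cp X} {A : ℕ → Set (Cp X)} {φ : ℕ → ℕ}
    (hφ : φ.Injective)
    (h : ∃ ℱ : ℕ → Set (Cp X), (∀ n, (ℱ n).Finite ∧ ℱ n ⊆ A (φ n)) ∧ ℱ ∈ OmegaAt f) :
    ∃ ℱ : ℕ → Set (Cp X), (∀ n, (ℱ n).Finite ∧ ℱ n ⊆ A n) ∧ ℱ ∈ OmegaAt f := by
  obtain ⟨ℱ, hℱ, hΩ⟩ := h
  refine ⟨Function.extend φ ℱ fun _ ↦ ∅, fun m ↦ ?_, fun K ε hε ↦ ?_⟩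
  · by_cases hm : ∃ n, φ n = m
    · obtain ⟨n, rfl⟩ := hm
      rw [hφ.extend_apply]
      exact hℱ n
    · rw [Function.extend_apply' _ _ _ hm]
      exact ⟨Set.finite_empty, Set.empty_subset _⟩
  · obtain ⟨n, hn⟩ := hΩ K ε hε
    refine ⟨φ n, ?_⟩
    rwa [hφ.extend_apply]

theorem uFinCp_gammaAt_of_uFinCovers (h : UFinCovers (GammaFCovers X) (OmegaCovers X))
    (f : Cp X) : UFinCp (GammaAt f) (OmegaAt f) := by
  intro A hA
  let δ : ℕ → ℝ := fun n ↦ 1 / (n + 1)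
  have hδ : Tendsto δ atTop (𝓝 0) := tendsto_one_div_add_atTop_nhds_zero_nat
  by_cases hcov : ∃ᶠ n in atTop, ∃ ℱ ⊆ A n, ℱ.Finite ∧ ⋃ g ∈ ℱ, nearSet f (δ n) g = Set.univ
  · obtain ⟨φ, hφ, hcovφ⟩ := extraction_of_frequently_atTop hcov
    choose ℱ hℱA hℱ huniv using hcovφ
    exact exists_mem_omegaAt_of_comp_injective hφ.injective ⟨ℱ, fun n ↦ ⟨hℱ n, hℱA n⟩,
      mem_omegaAt_of_iUnion_nearSet_eq_univ (hδ.comp hφ.tendsto_atTop) huniv⟩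
  · obtain ⟨φ, hφ, hnosub⟩ := extraction_of_eventually_atTop (not_frequently.1 hcov)
    exact exists_mem_omegaAt_of_comp_injective hφ.injective
      (exists_mem_omegaAt_of_iUnion_nearSet_ne_univ h (fun n ↦ hA (φ n))
        (fun n ↦ Nat.one_div_pos_of_nat) (hδ.comp hφ.tendsto_atTop)
        fun n ℱ hℱA hℱ huniv ↦ hnosub n ⟨ℱ, hℱA, hℱ, huniv⟩)

end Selection

section SeqSeparableToPropertyV

theorem ne_zero_iff_exists_forall_le_abs {u : ℕ → ℝ} {a : ℝ} (hu : Tendsto u atTop (𝓝 a)) :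
    a ≠ 0 ↔ ∃ n : ℕ, ∀ m ≥ n, 1 / ((n : ℝ) + 1) ≤ |u m| := by
  constructor
  · intro ha
    have hhalf : |a| / 2 < |a| := half_lt_self (abs_pos.2 ha)
    obtain ⟨n, hn⟩ := eventually_atTop.1 ((hu.abs.eventually_const_le hhalf).and
      (tendsto_one_div_add_atTop_nhds_zero_nat.eventually_le_const (half_pos (abs_pos.2 ha))))
    exact ⟨n, fun m hm ↦ (hn n le_rfl).2.trans (hn m hm).1⟩
  · rintro ⟨n, hn⟩
    have hle : 1 / ((n : ℝ) + 1) ≤ |a| :=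
      ge_of_tendsto hu.abs ((eventually_ge_atTop n).mono hn)
    exact abs_pos.1 (Nat.one_div_pos_of_nat.trans_le hle)

universe u

variable {X : Type u} [TopologicalSpace X]

theorem propertyV_of_injective {K : Type u} [MetricSpace K] [SecondCountableTopology K]
    {i : X → K} (hi : Continuous i) (hinj : i.Injective)
    (hcoz : ∀ U : Set X, IsCozeroSet U → ∃ A, IsFSigma A ∧ i ⁻¹' A = U) : PropertyV X := by
  let f : X → Set.range i := Set.rangeFactorization i
  have hf : f.Bijective :=
    ⟨Set.rangeFactorization_injective.2 hinj, Set.rangeFactorization_surjective⟩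
  refine ⟨Set.range i, inferInstance, inferInstance, f, hi.subtype_mk _, hf, fun U hU ↦ ?_⟩
  obtain ⟨A, hA, rfl⟩ := hcoz U hU
  refine (isFSigma_iff_of_isInducing .subtypeVal).2 ⟨A, hA, ?_⟩
  exact (hf.surjective.image_preimage (Subtype.val ⁻¹' A)).symm

theorem propertyV_of_isSeqSeparable (hX : {f : X → ℝ | Continuous f}.SeparatesPoints)
    (hsep : IsSeqSeparable (Cp X)) : PropertyV X := by
  obtain ⟨D, hDc, hD⟩ := hsep
  rw [isSeqDense_iff] at hD
  have := hDc.to_subtype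
  let i : X → D → ℝ := fun x d ↦ d.1.1 x
  let _ : MetricSpace (D → ℝ) := metrizableSpaceMetric _
  refine propertyV_of_injective (i := i) (continuous_pi fun d ↦ d.1.2) ?_ ?_
  · intro x y hxy
    by_contra hne
    obtain ⟨g, hg, hgxy⟩ := hX hne
    obtain ⟨u, huD, hu⟩ := hD ⟨g, hg⟩
    have huxy (n : ℕ) : (u n).1 x = (u n).1 y := congrFun hxy ⟨u n, huD n⟩
    refine hgxy (tendsto_nhds_unique (tendsto_cp_iff.1 hu x) ?_)
    simpa only [huxy] using tendsto_cp_iff.1 hu y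
  · rintro U ⟨g, hg, hU⟩
    obtain ⟨u, huD, hu⟩ := hD ⟨g, hg⟩
    refine ⟨⋃ n : ℕ, {y | ∀ m ≥ n, 1 / ((n : ℝ) + 1) ≤ |y ⟨u m, huD m⟩|},
      ⟨_, fun n ↦ ?_, rfl⟩, ?_⟩
    · simp only [Set.ofPred_forall]
      exact isClosed_biInter fun m _ ↦ isClosed_le continuous_const (continuous_apply _).abs
    · rw [← compl_compl U, hU]
      ext x
      simpa [i] using (ne_zero_iff_exists_forall_le_abs (tendsto_cp_iff.1 hu x)).symm

end SeqSeparableToPropertyV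

section BaireOne

variable {X K : Type*} [TopologicalSpace K] {i : X → K} {g g₁ g₂ : X → ℝ}

/-- Functions on `X` of the first Baire class relative to a map `i` into a space `K`: pointwise
limits of sequences of functions `h ∘ i` with `h` continuous on `K`. Taking `h` on all of `K`
rather than on the range of `i` allows `h` to vary in the separable space `C(K, ℝ)` when `K` is
compact and metrizable. -/
def IsBaireOneAlong (i : X → K) (g : X → ℝ) : Prop :=
  ∃ h : ℕ → C(K, ℝ), ∀ x, Tendsto (fun n ↦ h n (i x)) atTop (𝓝 (g x))

theorem isBaireOneAlong_indicator [HasOuterApproxClosed K] {C : Set K} (hC : IsClosed C) :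
    IsBaireOneAlong i ((i ⁻¹' C).indicator 1) := by
  refine ⟨fun n ↦ ⟨fun y ↦ (hC.apprSeq n y : ℝ), by fun_prop⟩, fun x ↦ ?_⟩
  have hlim := tendsto_pi_nhds.1 (HasOuterApproxClosed.tendsto_apprSeq hC) (i x)
  have hval : ((C.indicator (fun _ ↦ 1) (i x) : NNReal) : ℝ) = (i ⁻¹' C).indicator 1 x := by
    by_cases hx : i x ∈ C <;> simp [hx]
  exact hval ▸ (NNReal.continuous_coe.tendsto _).comp hlim

namespace IsBaireOneAlong

theorem add (hg₁ : IsBaireOneAlong i g₁) (hg₂ : IsBaireOneAlong i g₂) :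
    IsBaireOneAlong i fun x ↦ g₁ x + g₂ x := by
  obtain ⟨h₁, hh₁⟩ := hg₁
  obtain ⟨h₂, hh₂⟩ := hg₂
  exact ⟨fun n ↦ h₁ n + h₂ n, fun x ↦ (hh₁ x).add (hh₂ x)⟩

theorem const_mul (c : ℝ) (hg : IsBaireOneAlong i g) : IsBaireOneAlong i fun x ↦ c * g x := by
  obtain ⟨h, hh⟩ := hg
  exact ⟨fun n ↦ c • h n, fun x ↦ (hh x).const_mul c⟩

theorem sub (hg₁ : IsBaireOneAlong i g₁) (hg₂ : IsBaireOneAlong i g₂) :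
    IsBaireOneAlong i fun x ↦ g₁ x - g₂ x := by
  simpa only [neg_one_mul, ← sub_eq_add_neg] using hg₁.add (hg₂.const_mul (-1))

theorem div (hg₁ : IsBaireOneAlong i g₁) (hg₂ : IsBaireOneAlong i g₂) (hpos : ∀ x, 0 < g₂ x) :
    IsBaireOneAlong i fun x ↦ g₁ x / g₂ x := by
  obtain ⟨h₁, hh₁⟩ := hg₁
  obtain ⟨h₂, hh₂⟩ := hg₂
  have hden (n : ℕ) (y : K) : max (h₂ n y) (1 / ((n : ℝ) + 1)) ≠ 0 :=
    (Nat.one_div_pos_of_nat.trans_le (le_max_right _ _)).ne'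
  refine ⟨fun n ↦ ⟨fun y ↦ h₁ n y / max (h₂ n y) (1 / ((n : ℝ) + 1)), ?_⟩, fun x ↦ ?_⟩
  · exact (h₁ n).continuous.div ((h₂ n).continuous.max continuous_const) (hden n)
  · have hlim := (hh₂ x).max (tendsto_one_div_add_atTop_nhds_zero_nat (𝕜 := ℝ))
    rw [max_eq_left (hpos x).le] at hlim
    exact (hh₁ x).div hlim (hpos x).ne'

theorem tsum {ι : Type*} {G : ι → X → ℝ} {c : ι → ℝ} (hG : ∀ k, IsBaireOneAlong i (G k))
    (hc : Summable c) (hGc : ∀ k x, |G k x| ≤ c k) : IsBaireOneAlong i fun x ↦ ∑' k, G k x := by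
  choose h hh using hG
  -- Truncating the approximations at the bounds of their limits makes the series converge
  -- uniformly on `K`; Tannery's theorem then exchanges the limit and the sum.
  let t (k : ι) (n : ℕ) (y : K) : ℝ := max (-|c k|) (min |c k| (h k n y))
  have htcont (n : ℕ) (k : ι) : Continuous (t k n) := by fun_prop
  have htc (n : ℕ) (k : ι) (y : K) : ‖t k n y‖ ≤ |c k| :=
    abs_le.2 ⟨le_max_left _ _, max_le (neg_le_self (abs_nonneg _)) (min_le_left _ _)⟩
  have htlim (k : ι) (x : X) : Tendsto (fun n ↦ t k n (i x)) atTop (𝓝 (G k x)) := by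
    have hGx := abs_le.1 ((hGc k x).trans (le_abs_self _))
    convert tendsto_const_nhds.max (tendsto_const_nhds.min (hh k x)) using 2
    rw [min_eq_right hGx.2, max_eq_right hGx.1]
  exact ⟨fun n ↦ ⟨fun y ↦ ∑' k, t k n y, continuous_tsum (htcont n) hc.abs (htc n)⟩, fun x ↦
    tendsto_tsum_of_dominated_convergence hc.abs (htlim · x)
      (Eventually.of_forall fun n k ↦ htc n k (i x))⟩

theorem of_uniform_approx
    (hg : ∀ ε > 0, ∃ G, IsBaireOneAlong i G ∧ ∀ x, |G x - g x| ≤ ε) : IsBaireOneAlong i g := by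
  choose G hG hGg using fun n : ℕ ↦ hg ((1 / 2) ^ n) (by positivity)
  have hbound (n : ℕ) (x : X) : |G (n + 1) x - G n x| ≤ 2 * (1 / 2) ^ n := by
    calc |G (n + 1) x - G n x| ≤ |G (n + 1) x - g x| + |g x - G n x| := abs_sub_le _ _ _
      _ ≤ (1 / 2) ^ (n + 1) + (1 / 2) ^ n :=
        add_le_add (hGg _ x) (abs_sub_comm (g x) _ ▸ hGg n x)
      _ ≤ 2 * (1 / 2) ^ n := by
        rw [pow_succ]
        linarith [show (0 : ℝ) < (1 / 2) ^ n by positivity]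
  have hsum : Summable fun n : ℕ ↦ 2 * (1 / 2 : ℝ) ^ n := summable_geometric_two.mul_left 2
  have hGlim (x : X) : Tendsto (fun n ↦ G n x) atTop (𝓝 (g x)) :=
    tendsto_iff_dist_tendsto_zero.2 <| squeeze_zero (fun _ ↦ dist_nonneg) (hGg · x)
      (tendsto_pow_atTop_nhds_zero_of_lt_one (by norm_num) (by norm_num))
  have htel (x : X) : ∑' n, (G (n + 1) x - G n x) = g x - G 0 x := by
    have hs : Summable fun n ↦ G (n + 1) x - G n x := hsum.of_norm_bounded (hbound · x)
    refine tendsto_nhds_unique hs.hasSum.tendsto_sum_nat ?_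
    simpa only [Finset.sum_range_sub (G · x)] using (hGlim x).sub_const (G 0 x)
  simpa only [htel, add_sub_cancel] using
    (hG 0).add (IsBaireOneAlong.tsum (fun n ↦ (hG (n + 1)).sub (hG n)) hsum hbound)

end IsBaireOneAlong

theorem abs_tsum_mul_div_tsum_sub_le {ι : Type*} {p c : ι → ℝ} {a ε : ℝ} (hp : ∀ k, 0 ≤ p k)
    (hps : Summable p) (hpc : Summable fun k ↦ c k * p k) (hpos : 0 < ∑' k, p k)
    (hc : ∀ k, p k ≠ 0 → |c k - a| ≤ ε) : |(∑' k, c k * p k) / ∑' k, p k - a| ≤ ε := by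
  have hterm (k : ι) : ‖(c k - a) * p k‖ ≤ ε * p k := by
    rw [Real.norm_eq_abs, abs_mul, abs_of_nonneg (hp k)]
    rcases eq_or_ne (p k) 0 with hk | hk
    · simp only [hk, mul_zero, le_refl]
    · exact mul_le_mul_of_nonneg_right (hc k hk) (hp k)
  have hdiff : ∑' k, (c k - a) * p k = ∑' k, c k * p k - a * ∑' k, p k := by
    simp only [sub_mul]
    rw [hpc.tsum_sub (hps.mul_left a), tsum_mul_left]
  rw [div_sub' hpos.ne', abs_div, abs_of_pos hpos, div_le_iff₀ hpos, mul_comm _ a, ← hdiff,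
    ← tsum_mul_left]
  exact tsum_of_norm_bounded (hps.mul_left ε).hasSum hterm

theorem exists_isBaireOneAlong_abs_sub_le {ι : Type*} [Countable ι] {B : ι → Set X} {c : ι → ℝ}
    {ε : ℝ} (hB : ∀ k, IsBaireOneAlong i ((B k).indicator 1)) (hcov : ∀ x, ∃ k, x ∈ B k)
    (hc : ∀ k, ∀ x ∈ B k, |c k - g x| ≤ ε) :
    ∃ G, IsBaireOneAlong i G ∧ ∀ x, |G x - g x| ≤ ε := by
  obtain ⟨w, hw0, hwsum⟩ : ∃ w : ι → ℝ, (∀ k, 0 < w k) ∧ Summable fun k ↦ w k * (1 + |c k|) := by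
    obtain ⟨v, hv0, _, hv, -⟩ := NNReal.exists_pos_sum_of_countable one_ne_zero ι
    refine ⟨fun k ↦ v k / (1 + |c k|), fun k ↦ div_pos (hv0 k) (by positivity), ?_⟩
    convert NNReal.summable_coe.2 hv.summable using 2 with k
    exact div_mul_cancel₀ _ (by positivity)
  -- The average of the values `c k` with weights `p k x` involves only those `k` with `x ∈ B k`.
  let p (k : ι) (x : X) : ℝ := w k * (B k).indicator 1 x
  have hp0 (k : ι) (x : X) : 0 ≤ p k x :=
    mul_nonneg (hw0 k).le (Set.indicator_nonneg (fun _ _ ↦ zero_le_one) x)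
  have hpw (k : ι) (x : X) : p k x ≤ w k :=
    mul_le_of_le_one_right (hw0 k).le (Set.indicator_le_self' (fun _ _ ↦ zero_le_one) x)
  have hp (k : ι) (x : X) : |p k x| ≤ w k * (1 + |c k|) := by
    rw [abs_of_nonneg (hp0 k x)]
    nlinarith [hpw k x, hw0 k, abs_nonneg (c k)]
  have hcp (k : ι) (x : X) : |c k * p k x| ≤ w k * (1 + |c k|) := by
    rw [abs_mul, abs_of_nonneg (hp0 k x)]
    nlinarith [hpw k x, hw0 k, abs_nonneg (c k)]
  have hps (x : X) : Summable (p · x) := hwsum.of_norm_bounded (hp · x)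
  have hpos (x : X) : 0 < ∑' k, p k x := by
    obtain ⟨k, hk⟩ := hcov x
    exact (hps x).tsum_pos (hp0 · x) k (by simpa [p, hk] using hw0 k)
  have hpB (k : ι) : IsBaireOneAlong i (p k) := (hB k).const_mul (w k)
  refine ⟨fun x ↦ (∑' k, c k * p k x) / ∑' k, p k x, ?_, fun x ↦ ?_⟩
  · exact (IsBaireOneAlong.tsum (fun k ↦ (hpB k).const_mul (c k)) hwsum hcp).div
      (IsBaireOneAlong.tsum hpB hwsum hp) hpos
  · refine abs_tsum_mul_div_tsum_sub_le (hp0 · x) (hps x) (hwsum.of_norm_bounded (hcp · x))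
      (hpos x) fun k hk ↦ hc k x (by_contra fun hx ↦ hk ?_)
    simp only [p, Set.indicator_of_notMem hx, mul_zero]

theorem isBaireOneAlong_of_isFSigma [HasOuterApproxClosed K]
    (hg : ∀ (q : ℚ) (ε : ℝ), ∃ A, IsFSigma A ∧ i ⁻¹' A = {x | |g x - q| < ε}) :
    IsBaireOneAlong i g := by
  refine IsBaireOneAlong.of_uniform_approx fun ε hε ↦ ?_
  choose A hA hAg using fun q ↦ hg q ε
  choose C hC hAC using hA
  have hmem (q : ℚ) (x : X) : (∃ n, i x ∈ C q n) ↔ |g x - q| < ε := by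
    rw [← Set.mem_iUnion, ← hAC]
    exact Set.ext_iff.1 (hAg q) x
  refine exists_isBaireOneAlong_abs_sub_le (ι := ℚ × ℕ) (B := fun k ↦ i ⁻¹' C k.1 k.2)
    (c := fun k ↦ k.1) (fun k ↦ isBaireOneAlong_indicator (hC k.1 k.2)) (fun x ↦ ?_) ?_
  · obtain ⟨q, hq⟩ := Rat.denseRange_cast.exists_dist_lt (g x) hε
    obtain ⟨n, hn⟩ := (hmem q x).2 hq
    exact ⟨(q, n), hn⟩
  · rintro ⟨q, n⟩ x hx
    rw [abs_sub_comm]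
    exact ((hmem q x).1 ⟨n, hx⟩).le

end BaireOne

section PropertyVToSeqSeparable

variable {X : Type*} [TopologicalSpace X]

theorem PropertyV.exists_map_hilbertCube (hV : PropertyV X) :
    ∃ i : X → ℕ → unitInterval, Continuous i ∧
      ∀ U : Set X, IsCozeroSet U → ∃ A, IsFSigma A ∧ i ⁻¹' A = U := by
  obtain ⟨Y, _, _, f, hf, hbij, hfσ⟩ := hV
  obtain ⟨e, he⟩ := Metric.PiNatEmbed.exists_embedding_to_hilbert_cube (X := Y)
  refine ⟨e ∘ f, he.continuous.comp hf, fun U hU ↦ ?_⟩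
  obtain ⟨A, hA, hAU⟩ := (isFSigma_iff_of_isInducing he.isInducing).1 (hfσ U hU)
  exact ⟨A, hA, by rw [Set.preimage_comp, hAU, hbij.injective.preimage_image]⟩

theorem isSeqSeparable_cp_of_isBaireOneAlong {K : Type*} [TopologicalSpace K] [CompactSpace K]
    [SeparableSpace C(K, ℝ)] {i : X → K} (hi : Continuous i)
    (hB : ∀ g : X → ℝ, Continuous g → IsBaireOneAlong i g) : IsSeqSeparable (Cp X) := by
  let d : ℕ → C(K, ℝ) := denseSeq C(K, ℝ)
  refine ⟨Set.range fun k ↦ ⟨d k ∘ i, (d k).continuous.comp hi⟩, Set.countable_range _,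
    isSeqDense_iff.2 fun g ↦ ?_⟩
  obtain ⟨h, hh⟩ := hB g.1 g.2
  choose k hk using fun n : ℕ ↦ (denseRange_denseSeq C(K, ℝ)).exists_dist_lt (h n)
    (Nat.one_div_pos_of_nat (α := ℝ) (n := n))
  refine ⟨fun n ↦ _, fun n ↦ ⟨k n, rfl⟩, tendsto_cp_iff.2 fun x ↦ (hh x).congr_dist ?_⟩
  exact squeeze_zero (fun _ ↦ dist_nonneg)
    (fun n ↦ (ContinuousMap.dist_apply_le_dist (i x)).trans (hk n).le)
    tendsto_one_div_add_atTop_nhds_zero_nat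

theorem PropertyV.isSeqSeparable_cp (hV : PropertyV X) : IsSeqSeparable (Cp X) := by
  obtain ⟨i, hi, hcoz⟩ := hV.exists_map_hilbertCube
  exact isSeqSeparable_cp_of_isBaireOneAlong hi fun g hg ↦ isBaireOneAlong_of_isFSigma fun q ε ↦
    hcoz _ (isCozeroSet_lt (hg.sub continuous_const).abs continuous_const)

end PropertyVToSeqSeparable

end SelectionCp

open SelectionCp in
theorem mainTheorem6_general {X : Type*} [TopologicalSpace X]
    (hX : {f : X → ℝ | Continuous f}.SeparatesPoints) :
    List.TFAE [
      UFinCp (SeqDenseSets (Cp X)) (DenseSequences X) ∧ IsSeqSeparable (Cp X),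
      UFinCovers (GammaFCovers X) (OmegaCovers X) ∧ PropertyV X,
      (∀ f : Cp X, UFinCp (GammaAt f) (OmegaAt f)) ∧ IsSeqSeparable (Cp X),
      (∀ f : Cp X, UFinCp (SeqDenseSets (Cp X)) (OmegaAt f)) ∧ IsSeqSeparable (Cp X)] := by
  tfae_have 1 ↔ 4 := and_congr_left fun hsep ↦
    have := hsep.separableSpace
    uFinCp_denseSequences_iff
  tfae_have 4 → 2 := fun ⟨h, hsep⟩ ↦
    ⟨uFinCovers_of_uFinCp_seqDenseSets (h ⟨0, continuous_zero⟩),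
      propertyV_of_isSeqSeparable hX hsep⟩
  tfae_have 2 → 3 := fun ⟨h, hV⟩ ↦ ⟨uFinCp_gammaAt_of_uFinCovers h, hV.isSeqSeparable_cp⟩
  tfae_have 3 → 4 := fun ⟨h, hsep⟩ ↦ ⟨fun f ↦ uFinCp_seqDenseSets_of_gammaAt (h f), hsep⟩
  tfae_finish

theorem mainTheorem6 (X : Type*) [TopologicalSpace X] [T35Space X] :
    List.TFAE [
      SelectionCp.UFinCp (SelectionCp.SeqDenseSets (SelectionCp.Cp X))
          (SelectionCp.DenseSequences X) ∧
        SelectionCp.IsSeqSeparable (SelectionCp.Cp X),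
      SelectionCp.UFinCovers (SelectionCp.GammaFCovers X) (SelectionCp.OmegaCovers X) ∧
        SelectionCp.PropertyV X,
      (∀ f : SelectionCp.Cp X,
          SelectionCp.UFinCp (SelectionCp.GammaAt f) (SelectionCp.OmegaAt f)) ∧
        SelectionCp.IsSeqSeparable (SelectionCp.Cp X),
      (∀ f : SelectionCp.Cp X,
          SelectionCp.UFinCp (SelectionCp.SeqDenseSets (SelectionCp.Cp X))
            (SelectionCp.OmegaAt f)) ∧
        SelectionCp.IsSeqSeparable (SelectionCp.Cp X)] :=
  mainTheorem6_general separatesPoints_continuous_of_t35Space
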